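/- Let $T>0$ and let $(\Omega,\mathcal F,(\mathcal F_t)_{0\le t\le T},\mathbf P)$ be a filtered probability space whose filtration is right-continuous and contains all $\mathbf P$-null sets, with $\mathcal F_0$ $\mathbf P$-trivial and $\mathcal F_T=\mathcal F$. Let $S=(S_t)_{0\le t\le T}$ be an adapted process with càdlàg, strictly positive paths and $S_t\in L^1(\mathcal F_t,\mathbf P)$ for all $t$, and let $0<\lambda<1$. For $0\le s\le T$ and $0<\lambda'<1$, let $\mathrm{CPS}(s,T,\lambda')$ be the set of pairs $(\mathbf Q,\tilde S)$ such that $\mathbf Q$ is a probability measure on $\mathcal F_T$ equivalent to $\mathbf P$, $\tilde S=(\tilde S_u)_{s\le u\le T}$ is a martingale under $\mathbf Q$ on $[s,T]$, and for every $u\in[s,T]$ $$(1-\lambda')S_u\le\tilde S_u\le(1+\lambda')S_u\quad\text{a.s.}$$ Write $\mathrm{CPS}(s,T)=\mathrm{CPS}(s,T,\lambda)$, and let $L^p_+(\mathcal F_s,\mathcal Q)$ be the set of nonnegative $\mathcal F_s$-measurable random variables that lie in $L^p(\mathbf Q)$ for every $\mathbf Q$ for which there is a pair $(\mathbf Q,\tilde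 S)\in\mathrm{CPS}(s,T)$. Assume that $\mathrm{CPS}(0,T,\lambda')\neq\emptyset$ for every $0<\lambda'\le\lambda$. Let $s\in[0,T]$, and let $X_T^1,X_T^2$ be real-valued $\mathcal F_T$-measurable random variables such that, almost surely, $$X_T^1+(X_T^2)^+(1-\lambda)S_T-(X_T^2)^-(1+\lambda)S_T\ \ge\ -M_s^1-M_s^2S_T$$ for some $(M_s^1,M_s^2)\in L^1_+(\mathcal F_s,\mathcal Q)\times L^\infty_+(\mathcal F_s,\mathcal Q)$. Then, for every $(\mathbf Q,\tilde S)$ in $\mathrm{CPS}(r,T)$ with $0\le r\le s$, the negative part of $X_T^1+X_T^2\tilde S_T$ is $\mathbf Q$-integrable, so that the conditional expectations below are well defined with values in $(-\infty,\infty]$, and, almost surely, $$\operatorname*{ess\,sup}_{(\mathbf Q,\tilde S)\in\mathrm{CPS}(s,T)}\mathbf E_{\mathbf Q}\big[X_T^1+X_T^2\tilde S_T\mid\mathcal F_s\big]=\operatorname*{ess\,sup}_{(\mathbf Q,\tilde S)\in\mathrm{CPS}(0,T)}\mathbf E_{\mathbf Q}\big[X_T^1+X_T^2\tilde S_T\mid\mathcal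 F_s\big].$$ -/

import Mathlib

open MeasureTheory Filter
open scoped Topology ENNReal

noncomputable section

namespace TransactionCosts

/-- The time `0` of the interval `[0,T]`. -/
def tZero {T : ℝ} (hT : 0 < T) : Set.Icc (0 : ℝ) T := ⟨0, le_rfl, hT.le⟩

/-- The terminal time `T` of the interval `[0,T]`. -/
def tEnd {T : ℝ} (hT : 0 < T) : Set.Icc (0 : ℝ) T := ⟨T, hT.le, le_rfl⟩

/-- The terminal time `T` as an element of `[s,T]`. -/
def tEndFrom {T : ℝ} (hT : 0 < T) (s : Set.Icc (0 : ℝ) T) : Set.Ici s :=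
  ⟨tEnd hT, s.2.2⟩

/-- Càdlàg paths on `[0,T]`: right-continuous with finite left limits
(at `0` and `T` the one-sided condition that makes no sense is empty). -/
def IsCadlag {T : ℝ} (f : Set.Icc (0 : ℝ) T → ℝ) : Prop :=
  ∀ t, ContinuousWithinAt f (Set.Ici t) t ∧ ∃ l : ℝ, Tendsto f (𝓝[<] t) (𝓝 l)

variable {Ω : Type*} {mΩ : MeasurableSpace Ω} {T : ℝ}

/-- The filtration `(𝓕 u)` restricted to the times `u` in `[s,T]`. -/
def filtrationFrom (𝓕 : Filtration (Set.Icc (0 : ℝ) T) mΩ) (s : Set.Icc (0 : ℝ) T) :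
    Filtration (Set.Ici s) mΩ where
  seq u := 𝓕 u.1
  mono' _ _ h := 𝓕.mono h
  le' u := 𝓕.le u.1

/-- `(Q, St)` is a consistent price system on `[s,T]` for the price process `S` and proportional
transaction costs `lam`: `Q` is a probability measure equivalent to `P`, and
`St = (St u)_{s ≤ u ≤ T}` is a `Q`-martingale on `[s,T]` with values in the bid-ask spread. -/
structure IsCPS (𝓕 : Filtration (Set.Icc (0 : ℝ) T) mΩ) (P : Measure Ω)
    (S : Set.Icc (0 : ℝ) T → Ω → ℝ) (lam : ℝ) (s : Set.Icc (0 : ℝ) T)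
    (Q : Measure Ω) (St : Set.Ici s → Ω → ℝ) : Prop where
  prob : IsProbabilityMeasure Q
  ac : Q ≪ P
  ac' : P ≪ Q
  martingale : Martingale St (filtrationFrom 𝓕 s) Q
  spread : ∀ u : Set.Ici s, ∀ᵐ ω ∂P,
    (1 - lam) * S u.1 ω ≤ St u ω ∧ St u ω ≤ (1 + lam) * S u.1 ω

/-- `f` belongs to the nonnegative cone of `L^p(𝓕 s, 𝒬)`, the intersection of the spaces
`L^p(𝓕 s, Q)` over all `Q` that are part of a consistent price system on `[s,T]`. -/
def MemLpPlus (𝓕 : Filtration (Set.Icc (0 : ℝ) T) mΩ) (P : Measure Ω)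
    (S : Set.Icc (0 : ℝ) T → Ω → ℝ) (lam : ℝ) (s : Set.Icc (0 : ℝ) T)
    (p : ℝ≥0∞) (f : Ω → ℝ) : Prop :=
  Measurable[𝓕 s] f ∧ (∀ᵐ ω ∂P, 0 ≤ f ω) ∧
    ∀ (Q : Measure Ω) (St : Set.Ici s → Ω → ℝ), IsCPS 𝓕 P S lam s Q St → MemLp f p Q

/-- The conditional expectation `E_Q[X | m] = E_Q[X⁺ | m] - E_Q[X⁻ | m]`, with values in the
extended reals, of a random variable `X` whose negative part is `Q`-integrable
(`X` itself need not be integrable). -/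
def condExpE (m : MeasurableSpace Ω) (Q : Measure[mΩ] Ω) (X : Ω → ℝ) (ω : Ω) : EReal :=
  (condLExp m Q (fun ω' => ENNReal.ofReal (X ω')) ω : EReal) -
    (condLExp m Q (fun ω' => ENNReal.ofReal (-X ω')) ω : EReal)

/-- `Y` is (a version of) the essential supremum under `P` of the family `Φ` of extended real
random variables: the almost surely smallest random variable which dominates every member of `Φ`
almost surely. -/
structure IsEssSup (P : Measure Ω) (Φ : Set (Ω → EReal)) (Y : Ω → EReal) : Prop where
  measurable : Measurable Y
  upper : ∀ f ∈ Φ, f ≤ᵐ[P] Y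
  least : ∀ Y' : Ω → EReal, Measurable Y' → (∀ f ∈ Φ, f ≤ᵐ[P] Y') → Y ≤ᵐ[P] Y'

/-- Any two versions of an essential supremum agree almost surely. -/
theorem IsEssSup.ae_eq {P : Measure Ω} {Φ : Set (Ω → EReal)} {Y Y' : Ω → EReal}
    (h : IsEssSup P Φ Y) (h' : IsEssSup P Φ Y') : Y =ᵐ[P] Y' :=
  (h.least Y' h'.measurable h'.upper).antisymm (h'.least Y h.measurable h.upper)

/-- The value at time `T` of the claim `(X1, X2)` in the frictionless price `St`. -/
def payoff (hT : 0 < T) (X1 X2 : Ω → ℝ) {r : Set.Icc (0 : ℝ) T} (St : Set.Ici r → Ω → ℝ)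
    (ω : Ω) : ℝ :=
  X1 ω + X2 ω * St (tEndFrom hT r) ω

/-- The family of the conditional expectations `E_Q[X1 + X2 * St_T | 𝓕 s]`, where `(Q, St)` runs
through the consistent price systems on `[r,T]`. -/
def condValues (hT : 0 < T) (𝓕 : Filtration (Set.Icc (0 : ℝ) T) mΩ) (P : Measure Ω)
    (S : Set.Icc (0 : ℝ) T → Ω → ℝ) (lam : ℝ) (X1 X2 : Ω → ℝ) (r s : Set.Icc (0 : ℝ) T) :
    Set (Ω → EReal) :=
  {f | ∃ (Q : Measure Ω) (St : Set.Ici r → Ω → ℝ), IsCPS 𝓕 P S lam r Q St ∧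
    f = condExpE (𝓕 s) Q (payoff hT X1 X2 St)}

end TransactionCosts

end

/-! Restricting a consistent price system from [0,T] to [s,T] leaves its conditional value at s
unchanged, so one inequality is immediate (`condValues_subset`). The converse is hard because a
system (Q, St) on [s,T] need not extend backwards: St at time s may sit at the edge of the spread,
leaving no room for a martingale before s.

The remedy is a small perturbation (`IsCPS.exists_mixture`). Reweight Q on `𝓕 s` so that it agrees
there with Q', where (Q', St') is a system on [0,T] for tiny costs lam', and mix with weights 1 - ε
and ε. Take as terminal price the density-weighted average of both terminal prices, and close it to
a martingale by conditional expectation. After s the spread holds for each component; at s the mixed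
price obeys the reduced cost (1 - ε) * lam + ε * lam', and the gap to lam absorbs the error of going
back along Q'.

In `IsCPS.condExpE_le_of_upper_bound` the claim is shifted by M = M1 + M2 * S_T to become
nonnegative. The Q' component of the shifted claim can then be dropped, and its contribution to the
shift is at most ε * K with K finite and independent of ε. Letting ε tend to 0 gives the bound. -/

namespace TransactionCosts

/-! ### Existence of a measurable essential supremum -/

/-- The essential supremum of a family of `m`-measurable extended real random variables exists and
has an `m`-measurable version. -/
theorem exists_measurable_isEssSup {Ω : Type*} {m mΩ : MeasurableSpace Ω} (hm : m ≤ mΩ)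
    (P : Measure Ω) [IsFiniteMeasure P] (Φ : Set (Ω → EReal)) (hΦ : ∀ f ∈ Φ, Measurable[m] f) :
    ∃ Y : Ω → EReal, Measurable[m] Y ∧ IsEssSup P Φ Y := by
  classical
  -- A strictly increasing map into [0,1]: integrals become finite, and equality of integrals of
  -- ordered functions forces the functions to agree a.e.
  let φ : EReal → ℝ≥0∞ := fun x => (ENNReal.orderIsoIicOneBirational (EReal.expOrderIso x) : ℝ≥0∞)
  have hφ : StrictMono φ := fun x y h =>
    ENNReal.orderIsoIicOneBirational.strictMono (EReal.expOrderIso.strictMono h)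
  have hφ1 : ∀ x, φ x ≤ 1 := fun x => (ENNReal.orderIsoIicOneBirational _).2
  have hφm : Measurable φ := hφ.monotone.measurable
  let sup : Set (Ω → EReal) → Ω → EReal := fun C ω => ⨆ f ∈ C, f ω
  have hsup_le : ∀ {C C' : Set (Ω → EReal)}, C ⊆ C' → ∀ ω, sup C ω ≤ sup C' ω :=
    fun h ω => biSup_mono fun f hf => h hf
  have hsup_meas : ∀ C : Set (Ω → EReal), C.Countable → C ⊆ Φ → Measurable[m] (sup C) :=
    fun C hC hCΦ => Measurable.biSup C hC fun f hf => hΦ f (hCΦ hf)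
  let 𝒞 : Set (Set (Ω → EReal)) := {C | C.Countable ∧ C ⊆ Φ}
  let v : Set (Ω → EReal) → ℝ≥0∞ := fun C => ∫⁻ ω, φ (sup C ω) ∂P
  have hne : (v '' 𝒞).Nonempty := ⟨_, ∅, ⟨Set.countable_empty, Set.empty_subset _⟩, rfl⟩
  obtain ⟨u, -, hu, hu𝒞⟩ := exists_seq_tendsto_sSup hne (OrderTop.bddAbove _)
  choose C hC hCu using hu𝒞
  -- The union of a maximizing sequence of countable subfamilies attains the supremum of `v`, so
  -- adding one more member cannot change its pointwise supremum except on a null set.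
  let D := ⋃ n, C n
  have hD : D ∈ 𝒞 := ⟨Set.countable_iUnion fun n => (hC n).1, Set.iUnion_subset fun n => (hC n).2⟩
  have hDv : ∀ C' ∈ 𝒞, v C' ≤ v D := by
    intro C' hC'
    refine (le_sSup (Set.mem_image_of_mem v hC')).trans (le_of_tendsto' hu fun n => ?_)
    rw [← hCu n]
    exact lintegral_mono fun ω => hφ.monotone (hsup_le (Set.subset_iUnion C n) ω)
  have hDm := hsup_meas D hD.1 hD.2
  refine ⟨sup D, hDm, hDm.mono hm le_rfl, fun f hf => ?_, fun Y' _ hY' => ?_⟩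
  · have hC' : insert f D ∈ 𝒞 := ⟨hD.1.insert f, Set.insert_subset hf hD.2⟩
    have hle : (fun ω => φ (sup D ω)) ≤ᵐ[P] fun ω => φ (sup (insert f D) ω) :=
      Eventually.of_forall fun ω => hφ.monotone (hsup_le (Set.subset_insert f D) ω)
    have hfin : ∫⁻ ω, φ (sup D ω) ∂P ≠ ∞ := by
      refine ((lintegral_mono fun ω => hφ1 (sup D ω)).trans_lt ?_).ne
      simp
    have hmeas : AEMeasurable (fun ω => φ (sup (insert f D) ω)) P :=
      (hφm.comp ((hsup_meas _ hC'.1 hC'.2).mono hm le_rfl)).aemeasurable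
    filter_upwards [ae_eq_of_ae_le_of_lintegral_le hle hfin hmeas (hDv _ hC')] with ω hω
    rw [hφ.injective hω]
    exact le_biSup (fun g : Ω → EReal => g ω) (Set.mem_insert f D)
  · have : ∀ᵐ ω ∂P, ∀ f ∈ D, f ω ≤ Y' ω :=
      (ae_ball_iff hD.1).2 fun f hf => hY' f (hD.2 hf)
    filter_upwards [this] with ω hω using iSup₂_le hω

/-! ### Conditional expectations and densities tested against nonnegative functions -/

section Lintegral

variable {Ω : Type*} {m mΩ : MeasurableSpace Ω}

theorem lintegral_mul_indicator_one {P : Measure Ω} {A : Set Ω} (hA : MeasurableSet A)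
    (X : Ω → ℝ≥0∞) : ∫⁻ ω, X ω * A.indicator 1 ω ∂P = ∫⁻ ω in A, X ω ∂P := by
  rw [← lintegral_indicator hA]
  congr with ω
  by_cases hω : ω ∈ A <;> simp [hω]

/-- Indicators of `m`-measurable sets already decide the comparison. Arbitrary nonnegative test
functions are allowed since the applications verify the hypothesis in that form, with no
integrability to check. -/
theorem ae_le_condLExp_of_forall_lintegral_le (hm : m ≤ mΩ) {P : Measure Ω} [IsFiniteMeasure P]
    {X Y : Ω → ℝ≥0∞} (hY : Measurable[m] Y)
    (h : ∀ f : Ω → ℝ≥0∞, Measurable[m] f → ∫⁻ ω, Y ω * f ω ∂P ≤ ∫⁻ ω, X ω * f ω ∂P) :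
    Y ≤ᵐ[P] condLExp m P X := by
  refine ae_le_of_ae_le_trim (hm := hm) ?_
  refine ae_le_of_forall_setLIntegral_le_of_sigmaFinite hY fun A hA _ => ?_
  rw [setLIntegral_condLExp_trim hm P X hA, setLIntegral_trim hm hY hA]
  have := h (A.indicator 1) (@Measurable.indicator Ω ℝ≥0∞ A 1 m _ _ measurable_const hA)
  rwa [lintegral_mul_indicator_one (hm _ hA), lintegral_mul_indicator_one (hm _ hA)] at this

theorem condLExp_ae_le_of_forall_lintegral_le (hm : m ≤ mΩ) {P : Measure Ω} [IsFiniteMeasure P]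
    {X Y : Ω → ℝ≥0∞} (hY : Measurable[m] Y)
    (h : ∀ f : Ω → ℝ≥0∞, Measurable[m] f → ∫⁻ ω, X ω * f ω ∂P ≤ ∫⁻ ω, Y ω * f ω ∂P) :
    condLExp m P X ≤ᵐ[P] Y := by
  refine ae_le_of_ae_le_trim (hm := hm) ?_
  refine ae_le_of_forall_setLIntegral_le_of_sigmaFinite (measurable_condLExp _ _ _) fun A hA _ => ?_
  rw [setLIntegral_condLExp_trim hm P X hA, setLIntegral_trim hm hY hA]
  have := h (A.indicator 1) (@Measurable.indicator Ω ℝ≥0∞ A 1 m _ _ measurable_const hA)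
  rwa [lintegral_mul_indicator_one (hm _ hA), lintegral_mul_indicator_one (hm _ hA)] at this

/-- Two functions with the same integral over every `m`-measurable set have the same integral
against every `m`-measurable function. -/
theorem lintegral_mul_eq_of_forall_setLIntegral_eq (hm : m ≤ mΩ) {P : Measure Ω}
    {X Y : Ω → ℝ≥0∞} (hX : Measurable X) (hY : Measurable Y)
    (h : ∀ A, MeasurableSet[m] A → ∫⁻ ω in A, X ω ∂P = ∫⁻ ω in A, Y ω ∂P)
    {f : Ω → ℝ≥0∞} (hf : Measurable[m] f) :
    ∫⁻ ω, X ω * f ω ∂P = ∫⁻ ω, Y ω * f ω ∂P := by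
  have htrim : (P.withDensity X).trim hm = (P.withDensity Y).trim hm := by
    refine @Measure.ext _ m _ _ fun A hA => ?_
    rw [trim_measurableSet_eq hm hA, trim_measurableSet_eq hm hA,
      withDensity_apply _ (hm _ hA), withDensity_apply _ (hm _ hA), h A hA]
  have hX' := lintegral_withDensity_eq_lintegral_mul P hX (hf.mono hm le_rfl)
  have hY' := lintegral_withDensity_eq_lintegral_mul P hY (hf.mono hm le_rfl)
  simp only [Pi.mul_apply] at hX' hY'
  rw [← hX', ← hY', ← lintegral_trim hm hf, ← lintegral_trim hm hf, htrim]

theorem lintegral_condLExp_mul (hm : m ≤ mΩ) {P : Measure Ω} [IsFiniteMeasure P]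
    {X : Ω → ℝ≥0∞} (hX : Measurable X) {f : Ω → ℝ≥0∞} (hf : Measurable[m] f) :
    ∫⁻ ω, condLExp m P X ω * f ω ∂P = ∫⁻ ω, X ω * f ω ∂P :=
  lintegral_mul_eq_of_forall_setLIntegral_eq hm (measurable_condLExp' _ _ _) hX
    (fun _ hA => setLIntegral_condLExp hm P X hA) hf

/-- The density of `Q'` with respect to `Q` on a sub-σ-algebra. -/
theorem exists_density_trim (hm : m ≤ mΩ) {Q Q' : Measure Ω} [IsFiniteMeasure Q]
    [IsFiniteMeasure Q'] (h : Q' ≪ Q) :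
    ∃ g : Ω → ℝ≥0∞, Measurable[m] g ∧
      ∀ f : Ω → ℝ≥0∞, Measurable[m] f → ∫⁻ ω, g ω * f ω ∂Q = ∫⁻ ω, f ω ∂Q' := by
  have hg : Measurable[m] ((Q'.trim hm).rnDeriv (Q.trim hm)) := Measure.measurable_rnDeriv _ _
  refine ⟨(Q'.trim hm).rnDeriv (Q.trim hm), hg, fun f hf => ?_⟩
  rw [← lintegral_trim hm hf]
  refine (lintegral_trim hm (hg.mul hf)).symm.trans ?_
  exact lintegral_rnDeriv_mul (h.trim hm) hf.aemeasurable

/-- Two finite measures have complementary densities with respect to their sum. -/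
theorem exists_complementary_densities (μ ν : Measure Ω) [IsFiniteMeasure μ] [IsFiniteMeasure ν] :
    ∃ D : Ω → ℝ, Measurable D ∧ (∀ ω, 0 ≤ D ω) ∧ (∀ ω, D ω ≤ 1) ∧
      (μ + ν).withDensity (fun ω => ENNReal.ofReal (D ω)) = μ ∧
      (μ + ν).withDensity (fun ω => ENNReal.ofReal (1 - D ω)) = ν := by
  have hle : μ ≤ μ + ν := Measure.le_add_right le_rfl
  -- The derivative is at most 1 only almost everywhere; truncation makes the bounds on the density
  -- hold everywhere.
  have hD : Measurable fun ω => (min (μ.rnDeriv (μ + ν) ω) 1).toReal := by fun_prop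
  have h1 : ∀ ω, (min (μ.rnDeriv (μ + ν) ω) 1).toReal ≤ 1 := fun ω =>
    ENNReal.toReal_le_of_le_ofReal zero_le_one (by simp)
  have hμ : (μ + ν).withDensity
      (fun ω => ENNReal.ofReal (min (μ.rnDeriv (μ + ν) ω) 1).toReal) = μ := by
    conv_rhs => rw [← Measure.withDensity_rnDeriv_eq μ (μ + ν) hle.absolutelyContinuous]
    refine withDensity_congr_ae ?_
    filter_upwards [Measure.rnDeriv_le_one_of_le hle] with ω hω
    rw [min_eq_left (by simpa using hω),
      ENNReal.ofReal_toReal (ne_top_of_le_ne_top ENNReal.one_ne_top hω)]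
  refine ⟨_, hD, fun ω => ENNReal.toReal_nonneg, h1, hμ, ?_⟩
  refine Measure.ext fun A hA => ?_
  have hsum : (μ + ν) A = μ A + (μ + ν).withDensity
      (fun ω => ENNReal.ofReal (1 - (min (μ.rnDeriv (μ + ν) ω) 1).toReal)) A := by
    nth_rw 2 [← hμ]
    rw [withDensity_apply _ hA, withDensity_apply _ hA, ← lintegral_add_left (by fun_prop),
      ← setLIntegral_one]
    congr with ω
    rw [← ENNReal.ofReal_add ENNReal.toReal_nonneg (sub_nonneg.2 (h1 ω))]
    simp
  rw [Measure.add_apply] at hsum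
  exact ((ENNReal.add_right_inj (measure_ne_top μ A)).1 hsum).symm

end Lintegral

/-! ### Consistent price systems and their backward extension -/

section ConsistentPriceSystems

variable {Ω : Type*} {mΩ : MeasurableSpace Ω} {T : ℝ} {𝓕 : Filtration (Set.Icc (0 : ℝ) T) mΩ}
  {P : Measure Ω} {S : Set.Icc (0 : ℝ) T → Ω → ℝ} {lam : ℝ} {r : Set.Icc (0 : ℝ) T}
  {Q : Measure Ω} {St : Set.Ici r → Ω → ℝ}

theorem IsCPS.restrict (h : IsCPS 𝓕 P S lam r Q St) {s : Set.Icc (0 : ℝ) T} (hrs : r ≤ s) :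
    IsCPS 𝓕 P S lam s Q fun u => St ⟨u.1, hrs.trans u.2⟩ where
  prob := h.prob
  ac := h.ac
  ac' := h.ac'
  martingale := ⟨fun u => h.martingale.1 ⟨u.1, hrs.trans u.2⟩, fun u v huv =>
    h.martingale.2 ⟨u.1, hrs.trans u.2⟩ ⟨v.1, hrs.trans v.2⟩ huv⟩
  spread u := h.spread ⟨u.1, hrs.trans u.2⟩

theorem IsCPS.mono (h : IsCPS 𝓕 P S lam r Q St) {lam' : ℝ} (hlam : lam ≤ lam')
    (hS : ∀ t ω, 0 < S t ω) : IsCPS 𝓕 P S lam' r Q St where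
  prob := h.prob
  ac := h.ac
  ac' := h.ac'
  martingale := h.martingale
  spread u := by
    filter_upwards [h.spread u] with ω hω
    have := mul_le_mul_of_nonneg_right hlam (hS u.1 ω).le
    exact ⟨by linarith [hω.1], by linarith [hω.2]⟩

theorem IsCPS.measurable (h : IsCPS 𝓕 P S lam r Q St) (u : Set.Ici r) : Measurable (St u) :=
  (h.martingale.1 u).measurable.mono (𝓕.le u.1) le_rfl

theorem IsCPS.nonneg (h : IsCPS 𝓕 P S lam r Q St) (hlam : lam ≤ 1) (hS : ∀ t ω, 0 < S t ω)
    (u : Set.Ici r) : ∀ᵐ ω ∂P, 0 ≤ St u ω := by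
  filter_upwards [h.spread u] with ω hω
  exact (mul_nonneg (sub_nonneg.2 hlam) (hS u.1 ω).le).trans hω.1

theorem IsCPS.integrable_price (h : IsCPS 𝓕 P S lam r Q St) (hlam : lam < 1)
    (hS : ∀ t ω, 0 < S t ω) (hSm : ∀ t, Measurable (S t)) (u : Set.Ici r) :
    Integrable (S u.1) Q := by
  refine ((h.martingale.integrable u).const_mul (1 - lam)⁻¹).mono'
    (hSm u.1).aestronglyMeasurable ?_
  filter_upwards [h.ac.ae_le (h.spread u)] with ω hω
  rw [Real.norm_of_nonneg (hS u.1 ω).le, ← div_eq_inv_mul, le_div_iff₀' (sub_pos.2 hlam)]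
  exact hω.1

/-- The martingale property in a form that permits unbounded test functions, both sides possibly
infinite. -/
theorem IsCPS.lintegral_mul_eq (h : IsCPS 𝓕 P S lam r Q St) (hlam : lam ≤ 1)
    (hS : ∀ t ω, 0 < S t ω) {u v : Set.Ici r} (huv : u ≤ v) {f : Ω → ℝ≥0∞}
    (hf : Measurable[𝓕 u.1] f) :
    ∫⁻ ω, ENNReal.ofReal (St v ω) * f ω ∂Q = ∫⁻ ω, ENNReal.ofReal (St u ω) * f ω ∂Q := by
  have := h.prob
  refine lintegral_mul_eq_of_forall_setLIntegral_eq (𝓕.le u.1) (h.measurable v).ennreal_ofReal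
    (h.measurable u).ennreal_ofReal (fun A hA => ?_) hf
  rw [← ofReal_integral_eq_lintegral_ofReal (h.martingale.integrable v).integrableOn
      (ae_restrict_of_ae (h.ac.ae_le (h.nonneg hlam hS v))),
    ← ofReal_integral_eq_lintegral_ofReal (h.martingale.integrable u).integrableOn
      (ae_restrict_of_ae (h.ac.ae_le (h.nonneg hlam hS u))), h.martingale.setIntegral_eq huv hA]

/-- The upper half of the spread, integrated against a measure dominated by `P`. -/
theorem IsCPS.lintegral_le (h : IsCPS 𝓕 P S lam r Q St) (hlam : -1 ≤ lam)
    {μ : Measure Ω} (hμ : μ ≪ P) (u : Set.Ici r) (f : Ω → ℝ≥0∞) (hSm : Measurable (S u.1))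
    (hf : Measurable f) :
    ∫⁻ ω, ENNReal.ofReal (St u ω) * f ω ∂μ ≤
      ENNReal.ofReal (1 + lam) * ∫⁻ ω, ENNReal.ofReal (S u.1 ω) * f ω ∂μ := by
  rw [← lintegral_const_mul _ (hSm.ennreal_ofReal.fun_mul hf)]
  refine lintegral_mono_ae ?_
  filter_upwards [hμ.ae_le (h.spread u)] with ω hω
  rw [← mul_assoc, ← ENNReal.ofReal_mul (by linarith)]
  gcongr
  exact hω.2

/-- The lower half of the spread, integrated against a measure dominated by `P`. -/
theorem IsCPS.le_lintegral (h : IsCPS 𝓕 P S lam r Q St) (hlam : lam ≤ 1)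
    {μ : Measure Ω} (hμ : μ ≪ P) (u : Set.Ici r) (f : Ω → ℝ≥0∞) (hSm : Measurable (S u.1))
    (hf : Measurable f) :
    ENNReal.ofReal (1 - lam) * ∫⁻ ω, ENNReal.ofReal (S u.1 ω) * f ω ∂μ ≤
      ∫⁻ ω, ENNReal.ofReal (St u ω) * f ω ∂μ := by
  rw [← lintegral_const_mul _ (hSm.ennreal_ofReal.fun_mul hf)]
  refine lintegral_mono_ae ?_
  filter_upwards [hμ.ae_le (h.spread u)] with ω hω
  rw [← mul_assoc, ← ENNReal.ofReal_mul (by linarith)]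
  gcongr
  exact hω.1

/-- Integrals of the price at two times, against a function known at both of them, are comparable. -/
theorem IsCPS.lintegral_price_le (h : IsCPS 𝓕 P S lam r Q St) (hlam0 : 0 ≤ lam) (hlam1 : lam ≤ 1)
    (hT : 0 < T) (hS : ∀ t ω, 0 < S t ω) (hSm : ∀ t, Measurable (S t)) (u v : Set.Ici r)
    {f : Ω → ℝ≥0∞} (hu : Measurable[𝓕 u.1] f) (hv : Measurable[𝓕 v.1] f) :
    ENNReal.ofReal (1 - lam) * ∫⁻ ω, ENNReal.ofReal (S u.1 ω) * f ω ∂Q ≤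
      ENNReal.ofReal (1 + lam) * ∫⁻ ω, ENNReal.ofReal (S v.1 ω) * f ω ∂Q := by
  have hf := hu.mono (𝓕.le u.1) le_rfl
  refine (h.le_lintegral hlam1 h.ac u f (hSm u.1) hf).trans
    (le_trans (le_of_eq ?_) (h.lintegral_le (by linarith) h.ac v f (hSm v.1) hf))
  rw [← h.lintegral_mul_eq hlam1 hS (u := u) (v := tEndFrom hT _) u.1.2.2 hu,
    ← h.lintegral_mul_eq hlam1 hS (u := v) (v := tEndFrom hT _) v.1.2.2 hv]

/-- Replaces the constant d / c of a price comparison by a larger b / a, cleared of denominators. -/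
theorem ofReal_mul_le_of_ratio {a b c d : ℝ} {x y : ℝ≥0∞} (ha : 0 ≤ a) (hb : 0 ≤ b) (hc : 0 < c)
    (hxy : ENNReal.ofReal c * x ≤ ENNReal.ofReal d * y) (h : a * d ≤ b * c) :
    ENNReal.ofReal a * x ≤ ENNReal.ofReal b * y := by
  have hc0 : ENNReal.ofReal c ≠ 0 := by simpa using hc
  refine (ENNReal.mul_le_mul_iff_right hc0 ENNReal.ofReal_ne_top).1 ?_
  calc ENNReal.ofReal c * (ENNReal.ofReal a * x)
      = ENNReal.ofReal a * (ENNReal.ofReal c * x) := by ring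
    _ ≤ ENNReal.ofReal a * (ENNReal.ofReal d * y) := by gcongr
    _ = ENNReal.ofReal (a * d) * y := by rw [ENNReal.ofReal_mul ha, mul_assoc]
    _ ≤ ENNReal.ofReal (b * c) * y := by gcongr
    _ = ENNReal.ofReal c * (ENNReal.ofReal b * y) := by rw [ENNReal.ofReal_mul hb]; ring

/-- A consistent price system `(Q, St)` on `[s,T]`, mixed with a small weight `ε` of a system
`(Q', St')` on `[0,T]` for much smaller transaction costs, extends to `[0,T]`. The resulting measure
`Qm` agrees with `Q'` on `𝓕 s`, and `D`, `1 - D` are the densities with respect to `Qm` of the two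
components of the mixture. -/
theorem IsCPS.exists_mixture (hT : 0 < T) (h_end : 𝓕 (tEnd hT) = mΩ)
    (hSa : StronglyAdapted 𝓕 S) (hS : ∀ t ω, 0 < S t ω) {lam' ε : ℝ} (hlam0 : 0 < lam)
    (hlam1 : lam < 1) (hlam0' : 0 < lam') (hlam_le : lam' ≤ lam) (hε0 : 0 < ε) (hε1 : ε < 1)
    (hup : (1 + ((1 - ε) * lam + ε * lam')) * (1 + lam') ≤ (1 + lam) * (1 - lam'))
    (hlow : (1 - lam) * (1 + lam') ≤ (1 - ((1 - ε) * lam + ε * lam')) * (1 - lam'))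
    {s : Set.Icc (0 : ℝ) T} {Q Q' : Measure Ω} {St : Set.Ici s → Ω → ℝ}
    {St' : Set.Ici (tZero hT) → Ω → ℝ}
    (h : IsCPS 𝓕 P S lam s Q St) (h' : IsCPS 𝓕 P S lam' (tZero hT) Q' St') :
    ∃ (Qm : Measure Ω) (SR : Set.Ici (tZero hT) → Ω → ℝ) (D : Ω → ℝ) (g : Ω → ℝ≥0∞),
      IsCPS 𝓕 P S lam (tZero hT) Qm SR ∧ Measurable D ∧ (∀ ω, 0 ≤ D ω) ∧ (∀ ω, D ω ≤ 1) ∧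
      (∀ ω, SR (tEndFrom hT _) ω =
        D ω * St (tEndFrom hT s) ω + (1 - D ω) * St' (tEndFrom hT _) ω) ∧
      Measurable[𝓕 s] g ∧
      (∀ f : Ω → ℝ≥0∞, Measurable[𝓕 s] f → ∫⁻ ω, g ω * f ω ∂Q = ∫⁻ ω, f ω ∂Qm) ∧
      (∀ f : Ω → ℝ≥0∞, Measurable[𝓕 s] f → ∫⁻ ω, f ω ∂Q' = ∫⁻ ω, f ω ∂Qm) ∧
      (∀ f : Ω → ℝ≥0∞, Measurable f → ∫⁻ ω, ENNReal.ofReal (D ω) * f ω ∂Qm =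
        ENNReal.ofReal (1 - ε) * ∫⁻ ω, g ω * f ω ∂Q) ∧
      (∀ f : Ω → ℝ≥0∞, Measurable f → ∫⁻ ω, ENNReal.ofReal (1 - D ω) * f ω ∂Qm =
        ENNReal.ofReal ε * ∫⁻ ω, f ω ∂Q') := by
  have := h.prob
  have := h'.prob
  have hlam1' : lam' < 1 := hlam_le.trans_lt hlam1
  have hSm : ∀ t, Measurable (S t) := fun t => (hSa t).measurable.mono (𝓕.le t) le_rfl
  obtain ⟨g, hg, hgQ⟩ := exists_density_trim (𝓕.le s) (h'.ac.trans h.ac')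
  have hg' : Measurable g := hg.mono (𝓕.le s) le_rfl
  have hgprob : IsProbabilityMeasure (Q.withDensity g) := ⟨by
    have := hgQ 1 measurable_const
    simpa [withDensity_apply] using this⟩
  -- Since `g` is `𝓕 s`-measurable, this reweighting keeps `St` a martingale on [s,T] while matching
  -- Q' on `𝓕 s`.
  set μ₁ : Measure Ω := ENNReal.ofReal (1 - ε) • Q.withDensity g
  set μ₂ : Measure Ω := ENNReal.ofReal ε • Q'
  have hfin₁ : IsFiniteMeasure μ₁ := Measure.smul_finite _ ENNReal.ofReal_ne_top
  have hfin₂ : IsFiniteMeasure μ₂ := Measure.smul_finite _ ENNReal.ofReal_ne_top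
  have hac₁ : μ₁ ≪ P :=
    (Measure.smul_absolutelyContinuous.trans (withDensity_absolutelyContinuous _ _)).trans h.ac
  have hac₂ : μ₂ ≪ P := Measure.smul_absolutelyContinuous.trans h'.ac
  have hint₁ : ∀ f : Ω → ℝ≥0∞, Measurable f →
      ∫⁻ ω, f ω ∂μ₁ = ENNReal.ofReal (1 - ε) * ∫⁻ ω, g ω * f ω ∂Q := fun f hf => by
    rw [lintegral_smul_measure, lintegral_withDensity_eq_lintegral_mul _ hg' hf]
    rfl
  have hint₂ : ∀ f : Ω → ℝ≥0∞, ∫⁻ ω, f ω ∂μ₂ = ENNReal.ofReal ε * ∫⁻ ω, f ω ∂Q' := fun f => by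
    rw [lintegral_smul_measure]
    rfl
  have hone : ENNReal.ofReal (1 - ε) + ENNReal.ofReal ε = 1 := by
    rw [← ENNReal.ofReal_add (by linarith) hε0.le]
    simp
  have hint : ∀ f : Ω → ℝ≥0∞, Measurable[𝓕 s] f → ∫⁻ ω, f ω ∂Q' = ∫⁻ ω, f ω ∂(μ₁ + μ₂) := by
    intro f hf
    rw [lintegral_add_measure, hint₁ f (hf.mono (𝓕.le s) le_rfl), hint₂, hgQ f hf, ← add_mul,
      hone, one_mul]
  have hRprob : IsProbabilityMeasure (μ₁ + μ₂) := ⟨by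
    have := hint 1 measurable_const
    simpa using this.symm⟩
  have hacR : μ₁ + μ₂ ≪ P := Measure.AbsolutelyContinuous.add_left hac₁ hac₂
  have hacR' : P ≪ μ₁ + μ₂ := by
    refine h'.ac'.trans (Measure.AbsolutelyContinuous.trans ?_
      (Measure.le_add_left le_rfl).absolutelyContinuous)
    exact Measure.absolutelyContinuous_smul (by simpa using hε0)
  obtain ⟨D, hD, hD0, hD1, hDμ₁, hDμ₂⟩ := exists_complementary_densities μ₁ μ₂
  have hdens₁ : ∀ f : Ω → ℝ≥0∞, Measurable f →
      ∫⁻ ω, ENNReal.ofReal (D ω) * f ω ∂(μ₁ + μ₂) = ∫⁻ ω, f ω ∂μ₁ := fun f hf => by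
    conv_rhs => rw [← hDμ₁, lintegral_withDensity_eq_lintegral_mul _ hD.ennreal_ofReal hf]
    rfl
  have hdens₂ : ∀ f : Ω → ℝ≥0∞, Measurable f →
      ∫⁻ ω, ENNReal.ofReal (1 - D ω) * f ω ∂(μ₁ + μ₂) = ∫⁻ ω, f ω ∂μ₂ := fun f hf => by
    conv_rhs => rw [← hDμ₂, lintegral_withDensity_eq_lintegral_mul _
      (hD.const_sub 1).ennreal_ofReal hf]
    rfl
  -- With these weights, integrating `G` against the mixture is integrating each terminal price
  -- against its own component.
  set G : Ω → ℝ := fun ω =>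
    D ω * St (tEndFrom hT s) ω + (1 - D ω) * St' (tEndFrom hT _) ω with hG
  have hGm : Measurable G :=
    (hD.mul (h.measurable _)).add ((hD.const_sub 1).mul (h'.measurable _))
  have hG0 : 0 ≤ᵐ[μ₁ + μ₂] G := by
    filter_upwards [hacR.ae_le (h.nonneg hlam1.le hS (tEndFrom hT s)),
      hacR.ae_le (h'.nonneg hlam1'.le hS (tEndFrom hT _))] with ω h1 h2
    exact add_nonneg (mul_nonneg (hD0 ω) h1) (mul_nonneg (sub_nonneg.2 (hD1 ω)) h2)
  have hGint : ∀ f : Ω → ℝ≥0∞, Measurable f →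
      ∫⁻ ω, ENNReal.ofReal (G ω) * f ω ∂(μ₁ + μ₂) =
        ∫⁻ ω, ENNReal.ofReal (St (tEndFrom hT s) ω) * f ω ∂μ₁ +
          ∫⁻ ω, ENNReal.ofReal (St' (tEndFrom hT _) ω) * f ω ∂μ₂ := by
    intro f hf
    have hm1 := (h.measurable (tEndFrom hT s)).ennreal_ofReal.fun_mul hf
    have hm2 := (h'.measurable (tEndFrom hT _)).ennreal_ofReal.fun_mul hf
    rw [← hdens₁ _ hm1, ← hdens₂ _ hm2, ← lintegral_add_left (hD.ennreal_ofReal.fun_mul hm1)]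
    refine lintegral_congr_ae ?_
    filter_upwards [hacR.ae_le (h.nonneg hlam1.le hS (tEndFrom hT s)),
      hacR.ae_le (h'.nonneg hlam1'.le hS (tEndFrom hT _))] with ω h1 h2
    rw [hG, ENNReal.ofReal_add (mul_nonneg (hD0 ω) h1) (mul_nonneg (sub_nonneg.2 (hD1 ω)) h2),
      ENNReal.ofReal_mul (hD0 ω), ENNReal.ofReal_mul (sub_nonneg.2 (hD1 ω)), add_mul, mul_assoc,
      mul_assoc]
  have hmart₁ : ∀ (u : Set.Ici s) (f : Ω → ℝ≥0∞), Measurable[𝓕 u.1] f →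
      ∫⁻ ω, ENNReal.ofReal (St (tEndFrom hT s) ω) * f ω ∂μ₁ =
        ∫⁻ ω, ENNReal.ofReal (St u ω) * f ω ∂μ₁ := by
    intro u f hf
    have hf' := hf.mono (𝓕.le u.1) le_rfl
    rw [hint₁ _ ((h.measurable _).ennreal_ofReal.fun_mul hf'),
      hint₁ _ ((h.measurable _).ennreal_ofReal.fun_mul hf')]
    have := h.lintegral_mul_eq hlam1.le hS (u := u) (v := tEndFrom hT s) u.1.2.2
      ((hg.mono (𝓕.mono u.2) le_rfl).mul hf)
    simp only [Pi.mul_apply] at this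
    simp only [mul_left_comm (g _), this]
  have hmart₂ : ∀ (u : Set.Ici (tZero hT)) (f : Ω → ℝ≥0∞), Measurable[𝓕 u.1] f →
      ∫⁻ ω, ENNReal.ofReal (St' (tEndFrom hT _) ω) * f ω ∂μ₂ =
        ∫⁻ ω, ENNReal.ofReal (St' u ω) * f ω ∂μ₂ := by
    intro u f hf
    rw [hint₂, hint₂, h'.lintegral_mul_eq hlam1'.le hS (u := u) u.1.2.2 hf]
  have hmix : ∀ a b : ℝ, 0 ≤ a → 0 ≤ b → ∀ f : Ω → ℝ≥0∞, Measurable[𝓕 s] f →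
      ENNReal.ofReal a * ∫⁻ ω, f ω ∂μ₁ + ENNReal.ofReal b * ∫⁻ ω, f ω ∂μ₂ =
        ENNReal.ofReal ((1 - ε) * a + ε * b) * ∫⁻ ω, f ω ∂Q' := by
    intro a b ha hb f hf
    rw [hint₁ f (hf.mono (𝓕.le s) le_rfl), hint₂, hgQ f hf, ENNReal.ofReal_add
      (mul_nonneg (by linarith) ha) (mul_nonneg hε0.le hb), ENNReal.ofReal_mul (by linarith),
      ENNReal.ofReal_mul hε0.le]
    ring
  -- The spread condition at every time, in tested form.
  have hbounds : ∀ (u : Set.Icc (0 : ℝ) T) (f : Ω → ℝ≥0∞), Measurable[𝓕 u] f →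
      ENNReal.ofReal (1 - lam) * ∫⁻ ω, ENNReal.ofReal (S u ω) * f ω ∂(μ₁ + μ₂) ≤
          ∫⁻ ω, ENNReal.ofReal (G ω) * f ω ∂(μ₁ + μ₂) ∧
        ∫⁻ ω, ENNReal.ofReal (G ω) * f ω ∂(μ₁ + μ₂) ≤
          ENNReal.ofReal (1 + lam) * ∫⁻ ω, ENNReal.ofReal (S u ω) * f ω ∂(μ₁ + μ₂) := by
    intro u f hf
    have hf' := hf.mono (𝓕.le u) le_rfl
    rw [hGint f hf']
    rcases le_total s u with hsu | hus
    · rw [hmart₁ ⟨u, hsu⟩ f hf, hmart₂ ⟨u, u.2.1⟩ f hf, lintegral_add_measure, mul_add, mul_add]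
      constructor
      · refine add_le_add (h.le_lintegral hlam1.le hac₁ ⟨u, hsu⟩ f (hSm u) hf')
          (le_trans ?_ (h'.le_lintegral hlam1'.le hac₂ ⟨u, u.2.1⟩ f (hSm u) hf'))
        gcongr
      · refine add_le_add (h.lintegral_le (by linarith) hac₁ ⟨u, hsu⟩ f (hSm u) hf')
          ((h'.lintegral_le (by linarith) hac₂ ⟨u, u.2.1⟩ f (hSm u) hf').trans ?_)
        gcongr
    -- Before s only Q' carries a price. Both components are brought to time s, where their sum is
    -- Q' with cost (1 - ε) * lam + ε * lam'; passing from s to u under Q' costs the factor (1 +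
    -- lam') / (1 - lam'), which `hup` and `hlow` absorb.
    · have hfs : Measurable[𝓕 s] f := hf.mono (𝓕.mono hus) le_rfl
      have hSs : Measurable[𝓕 s] fun ω => ENNReal.ofReal (S s ω) * f ω :=
        (hSa s).measurable.ennreal_ofReal.fun_mul hfs
      have hSu : Measurable[𝓕 s] fun ω => ENNReal.ofReal (S u ω) * f ω :=
        ((hSa u).measurable.mono (𝓕.mono hus) le_rfl).ennreal_ofReal.fun_mul hfs
      rw [hmart₁ ⟨s, Set.self_mem_Ici⟩ f hfs, hmart₂ ⟨s, s.2.1⟩ f hfs, ← hint _ hSu]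
      constructor
      · refine le_trans ?_ (add_le_add (h.le_lintegral hlam1.le hac₁ ⟨s, Set.self_mem_Ici⟩ f (hSm s)
          hf')
          (h'.le_lintegral hlam1'.le hac₂ ⟨s, s.2.1⟩ f (hSm s) hf'))
        rw [hmix _ _ (by linarith) (by linarith) _ hSs]
        exact ofReal_mul_le_of_ratio (by linarith) (by nlinarith) (by linarith)
          (h'.lintegral_price_le hlam0'.le hlam1'.le hT hS hSm ⟨u, u.2.1⟩ ⟨s, s.2.1⟩ hf hfs)
          (by linarith)
      · refine (add_le_add (h.lintegral_le (by linarith) hac₁ ⟨s, Set.self_mem_Ici⟩ f (hSm s)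
          hf')
          (h'.lintegral_le (by linarith) hac₂ ⟨s, s.2.1⟩ f (hSm s) hf')).trans ?_
        rw [hmix _ _ (by linarith) (by linarith) _ hSs]
        exact ofReal_mul_le_of_ratio (by nlinarith) (by linarith) (by linarith)
          (h'.lintegral_price_le hlam0'.le hlam1'.le hT hS hSm ⟨s, s.2.1⟩ ⟨u, u.2.1⟩ hfs hf)
          (by linarith)
  have hGi : Integrable G (μ₁ + μ₂) := by
    refine (lintegral_ofReal_ne_top_iff_integrable hGm.aestronglyMeasurable hG0).1 ?_
    have h1 := (hbounds s 1 measurable_const).2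
    simp only [Pi.one_apply, mul_one] at h1
    refine ne_top_of_le_ne_top (ENNReal.mul_ne_top ENNReal.ofReal_ne_top ?_) h1
    rw [← hint _ (hSa s).measurable.ennreal_ofReal]
    exact (lintegral_ofReal_ne_top_iff_integrable (hSm s).aestronglyMeasurable
      (ae_of_all _ fun ω => (hS s ω).le)).2
      (h'.integrable_price hlam1' hS hSm ⟨s, s.2.1⟩)
  refine ⟨μ₁ + μ₂, fun u => (μ₁ + μ₂)[G | 𝓕 u.1], D, g,
    ⟨hRprob, hacR, hacR', martingale_condExp G (filtrationFrom 𝓕 (tZero hT)) (μ₁ + μ₂),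
      fun u => ?_⟩, hD, hD0, hD1, fun ω => ?_, hg, fun f hf => ?_, hint, fun f hf => ?_,
      fun f hf => ?_⟩
  · have hSu := (hSa u.1).measurable
    have hlo := ae_le_condLExp_of_forall_lintegral_le (𝓕.le u.1) (P := μ₁ + μ₂)
      (X := fun ω => ENNReal.ofReal (G ω)) (Y := fun ω => ENNReal.ofReal ((1 - lam) * S u.1 ω))
      (hSu.const_mul _).ennreal_ofReal fun f hf => by
        refine le_of_eq_of_le ?_ (hbounds u.1 f hf).1
        rw [← lintegral_const_mul _
          ((hSm u.1).ennreal_ofReal.fun_mul (hf.mono (𝓕.le u.1) le_rfl))]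
        simp only [ENNReal.ofReal_mul (sub_nonneg.2 hlam1.le), mul_assoc]
    have hhi := condLExp_ae_le_of_forall_lintegral_le (𝓕.le u.1) (P := μ₁ + μ₂)
      (X := fun ω => ENNReal.ofReal (G ω)) (Y := fun ω => ENNReal.ofReal ((1 + lam) * S u.1 ω))
      (hSu.const_mul _).ennreal_ofReal fun f hf => by
        refine le_of_le_of_eq (hbounds u.1 f hf).2 ?_
        rw [← lintegral_const_mul _
          ((hSm u.1).ennreal_ofReal.fun_mul (hf.mono (𝓕.le u.1) le_rfl))]
        simp only [ENNReal.ofReal_mul (by linarith : 0 ≤ 1 + lam), mul_assoc]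
    refine hacR'.ae_le ?_
    filter_upwards [hlo, hhi, condLExp_ofReal (𝓕 u.1) hGi hG0] with ω h1 h2 h3
    rw [h3] at h1 h2
    have hSp := hS u.1 ω
    refine ⟨?_, (ENNReal.ofReal_le_ofReal_iff (mul_pos (by linarith) hSp).le).1 h2⟩
    rcases ENNReal.ofReal_le_ofReal_iff'.1 h1 with h1 | h1
    · exact h1
    · exact absurd h1 (not_le.2 (mul_pos (by linarith) hSp))
  · refine congrFun (condExp_of_stronglyMeasurable (𝓕.le _) ?_ hGi) ω
    change StronglyMeasurable[𝓕 (tEnd hT)] G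
    rw [h_end]
    exact hGm.stronglyMeasurable
  · rw [hgQ f hf, hint f hf]
  · rw [hdens₁ f hf, hint₁ f hf]
  · rw [hdens₂ f hf, hint₂ f]

end ConsistentPriceSystems

/-! ### Extended conditional values and the limit of vanishing perturbation -/

section ConditionalValues

variable {Ω : Type*} {mΩ : MeasurableSpace Ω}

theorem EReal_coe_sub_eq_of_add_eq {a b c d : ℝ≥0∞} (hc : c ≠ ∞) (hd : d ≠ ∞)
    (h : a + c = b + d) : (a : EReal) - (d : EReal) = (b : EReal) - (c : EReal) := by
  lift c to NNReal using hc
  lift d to NNReal using hd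
  induction a with
  | top =>
    have hb : b = ⊤ := by
      by_contra hb
      exact (ENNReal.add_ne_top.2 ⟨hb, ENNReal.coe_ne_top⟩) (by rw [← h, top_add])
    subst hb
    rfl
  | coe a =>
    have hb : b ≠ ⊤ := by
      rintro rfl
      rw [top_add] at h
      exact ENNReal.add_ne_top.2 ⟨ENNReal.coe_ne_top, ENNReal.coe_ne_top⟩ h
    lift b to NNReal using hb
    have h' : (a : ℝ) + c = b + d := by exact_mod_cast h
    have : ((a : ℝ) - d : ℝ) = (b : ℝ) - c := by linarith
    have := congrArg Real.toEReal this
    rw [EReal.coe_sub, EReal.coe_sub] at this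
    exact this

/-- The extended conditional expectation of `X` can be computed by shifting `X` by a nonnegative
integrable random variable which makes it nonnegative. -/
theorem condExpE_ae_eq_sub {Ω : Type*} (m : MeasurableSpace Ω) {mΩ : MeasurableSpace Ω}
    {Q : Measure Ω} {X M : Ω → ℝ}
    (hX : Measurable X) (hM : Measurable M) (hM0 : ∀ᵐ ω ∂Q, 0 ≤ M ω)
    (hXM : ∀ᵐ ω ∂Q, 0 ≤ X ω + M ω) (hMi : Integrable M Q) :
    ∀ᵐ ω ∂Q, condExpE m Q X ω =
      (condLExp m Q (fun ω' => ENNReal.ofReal (X ω' + M ω')) ω : EReal) -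
        (condLExp m Q (fun ω' => ENNReal.ofReal (M ω')) ω : EReal) := by
  have hMfin : ∫⁻ ω, ENNReal.ofReal (M ω) ∂Q ≠ ∞ :=
    (lintegral_ofReal_ne_top_iff_integrable hM.aestronglyMeasurable hM0).2 hMi
  have hneg : ∀ᵐ ω ∂Q, ENNReal.ofReal (-X ω) ≤ ENNReal.ofReal (M ω) := by
    filter_upwards [hXM] with ω hω
    exact ENNReal.ofReal_le_ofReal (by linarith)
  have hsum : (fun ω => ENNReal.ofReal (X ω)) + (fun ω => ENNReal.ofReal (M ω)) =ᵐ[Q]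
      (fun ω => ENNReal.ofReal (X ω + M ω)) + fun ω => ENNReal.ofReal (-X ω) := by
    filter_upwards [hM0, hXM] with ω h0 h1
    simp only [Pi.add_apply]
    rcases le_total 0 (X ω) with hx | hx
    · rw [← ENNReal.ofReal_add hx h0, ENNReal.ofReal_of_nonpos (neg_nonpos.2 hx), add_zero]
    · rw [← ENNReal.ofReal_add h1 (neg_nonneg.2 hx), ENNReal.ofReal_of_nonpos hx, zero_add]
      congr 1
      ring
  filter_upwards [condLExp_congr_ae (mΩ := m) hsum,
    condLExp_add_left (mΩ := m) (fun ω => ENNReal.ofReal (M ω)) hX.ennreal_ofReal.aemeasurable,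
    condLExp_add_left (mΩ := m) (fun ω => ENNReal.ofReal (-X ω))
      (hX.add hM).ennreal_ofReal.aemeasurable,
    condLExp_ne_top (mΩ := m) hMfin,
    condLExp_ne_top (mΩ := m) (ne_top_of_le_ne_top hMfin (lintegral_mono_ae hneg))]
    with ω h1 h2 h3 h4 h5
  refine EReal_coe_sub_eq_of_add_eq h4 h5 ?_
  rw [h2] at h1
  exact h1.trans h3

/-- Passage to the limit along `ε = 1 / (n + 2)` in a perturbed lower bound. -/
theorem EReal_sub_le_of_forall_perturbation {a b k : ℝ≥0∞} {y : EReal} (hb : b ≠ ∞) (hk : k ≠ ∞)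
    (h : ∀ n : ℕ, ((ENNReal.ofReal (1 - 1 / ((n : ℝ) + 2)) * a : ℝ≥0∞) : EReal) -
      ((ENNReal.ofReal (1 - 1 / ((n : ℝ) + 2)) * b + ENNReal.ofReal (1 / ((n : ℝ) + 2)) * k :
        ℝ≥0∞) : EReal) ≤ y) : (a : EReal) - (b : EReal) ≤ y := by
  have hpos : ∀ n : ℕ, 0 < 1 - 1 / ((n : ℝ) + 2) := fun n => by
    rw [sub_pos, div_lt_one (by positivity)]
    linarith [(Nat.cast_nonneg n : (0 : ℝ) ≤ n)]
  lift b to NNReal using hb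
  lift k to NNReal using hk
  induction a with
  | top =>
    -- One perturbation suffices here: at n = 0 the factor 1/2 leaves the first term infinite and
    -- the subtracted term is finite.
    have h0 := h 0
    rw [ENNReal.mul_top (by simpa using hpos 0)] at h0
    refine le_trans (le_of_eq ?_) h0
    have hfin : ENNReal.ofReal (1 - 1 / (((0 : ℕ) : ℝ) + 2)) * (b : ℝ≥0∞) +
        ENNReal.ofReal (1 / (((0 : ℕ) : ℝ) + 2)) * (k : ℝ≥0∞) ≠ ∞ := by finiteness
    lift (ENNReal.ofReal (1 - 1 / (((0 : ℕ) : ℝ) + 2)) * (b : ℝ≥0∞) +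
        ENNReal.ofReal (1 / (((0 : ℕ) : ℝ) + 2)) * (k : ℝ≥0∞)) to NNReal using hfin with c
    rfl
  | coe a =>
    have hlim : Tendsto (fun n : ℕ => (1 - 1 / ((n : ℝ) + 2)) * (a : ℝ) -
        ((1 - 1 / ((n : ℝ) + 2)) * b + 1 / ((n : ℝ) + 2) * k)) atTop (𝓝 ((a : ℝ) - b)) := by
      have h0 : Tendsto (fun n : ℕ => 1 / ((n : ℝ) + 2)) atTop (𝓝 0) :=
        tendsto_const_nhds.div_atTop
          (tendsto_natCast_atTop_atTop.atTop_add tendsto_const_nhds)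
      have h1 := h0.const_sub 1
      simpa using (h1.mul_const (a : ℝ)).sub ((h1.mul_const (b : ℝ)).add (h0.mul_const (k : ℝ)))
    have hlim' := EReal.tendsto_coe.2 hlim
    refine le_of_tendsto_of_tendsto' hlim' (tendsto_const_nhds (x := y)) fun n => ?_
    refine le_trans (le_of_eq ?_) (h n)
    have hc : ∀ x : ℝ, 0 ≤ x → ∀ c : NNReal,
        ENNReal.ofReal x * (c : ℝ≥0∞) = ENNReal.ofReal (x * c) := fun x hx c => by
      rw [ENNReal.ofReal_mul hx, ENNReal.ofReal_coe_nnreal]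
    have hn : (0 : ℝ) ≤ 1 / ((n : ℝ) + 2) := by positivity
    have hp := (hpos n).le
    rw [hc _ hp, hc _ hp, hc _ hn, ← ENNReal.ofReal_add (by positivity) (by positivity),
      EReal.coe_ennreal_ofReal, EReal.coe_ennreal_ofReal, max_eq_left (by positivity),
      max_eq_left (by positivity), EReal.coe_sub]

variable {T : ℝ} {𝓕 : Filtration (Set.Icc (0 : ℝ) T) mΩ}
  {P : Measure Ω} {S : Set.Icc (0 : ℝ) T → Ω → ℝ} {lam : ℝ} {r s : Set.Icc (0 : ℝ) T}
  {Q : Measure Ω} {X1 X2 M1 M2 : Ω → ℝ}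

theorem condValues_subset (hT : 0 < T) (hrs : r ≤ s) (t : Set.Icc (0 : ℝ) T) :
    condValues hT 𝓕 P S lam X1 X2 r t ⊆ condValues hT 𝓕 P S lam X1 X2 s t := by
  rintro f ⟨Q, St, h, rfl⟩
  exact ⟨Q, _, h.restrict hrs, rfl⟩

theorem measurable_condExpE (m : MeasurableSpace Ω) (Q : Measure[mΩ] Ω) (X : Ω → ℝ) :
    Measurable[m] (condExpE m Q X) := by
  have h1 := measurable_condLExp m Q fun ω => ENNReal.ofReal (X ω)
  have h2 := measurable_condLExp m Q fun ω => ENNReal.ofReal (-X ω)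
  have h3 := measurable_coe_ennreal_ereal.comp h1
  have h4 := measurable_coe_ennreal_ereal.comp h2
  exact h3.fun_sub h4

theorem IsCPS.measurable_payoff {St : Set.Ici r → Ω → ℝ} (h : IsCPS 𝓕 P S lam r Q St)
    (hT : 0 < T) (hX1 : Measurable X1) (hX2 : Measurable X2) :
    Measurable (payoff hT X1 X2 St) :=
  hX1.add (hX2.mul (h.measurable _))

/-- Liquidation uses the worse end of the spread for either sign of `X2`, so the frictionless value
dominates it. -/
theorem IsCPS.payoff_add_nonneg {St : Set.Ici r → Ω → ℝ} (h : IsCPS 𝓕 P S lam r Q St)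
    (hT : 0 < T) (h_bound : ∀ᵐ ω ∂P, -M1 ω - M2 ω * S (tEnd hT) ω ≤
        X1 ω + max (X2 ω) 0 * ((1 - lam) * S (tEnd hT) ω)
          - max (-X2 ω) 0 * ((1 + lam) * S (tEnd hT) ω)) :
    ∀ᵐ ω ∂P, 0 ≤ payoff hT X1 X2 St ω + (M1 ω + M2 ω * S (tEnd hT) ω) := by
  filter_upwards [h_bound, h.spread (tEndFrom hT r)] with ω h1 h2
  change (1 - lam) * S (tEnd hT) ω ≤ _ ∧ _ ≤ (1 + lam) * S (tEnd hT) ω at h2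
  simp only [payoff]
  rcases le_total 0 (X2 ω) with hx | hx
  · rw [max_eq_left hx, max_eq_right (by linarith)] at h1
    linarith [mul_le_mul_of_nonneg_left h2.1 hx]
  · rw [max_eq_right hx, max_eq_left (by linarith)] at h1
    linarith [mul_le_mul_of_nonpos_left h2.2 hx]

theorem IsCPS.integrable_bound {St : Set.Ici s → Ω → ℝ} (h : IsCPS 𝓕 P S lam s Q St)
    (hT : 0 < T) (hlam : lam < 1) (hS : ∀ t ω, 0 < S t ω) (hSm : ∀ t, Measurable (S t))
    (hM1 : MemLpPlus 𝓕 P S lam s 1 M1) (hM2 : MemLpPlus 𝓕 P S lam s ∞ M2) :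
    Integrable (fun ω => M1 ω + M2 ω * S (tEnd hT) ω) Q :=
  (memLp_one_iff_integrable.1 (hM1.2.2 Q St h)).add
    ((h.integrable_price hlam hS hSm (tEndFrom hT s)).mul_of_top_right (hM2.2.2 Q St h))

/-- Every conditional value of a consistent price system on `[s,T]` is dominated by the essential
supremum of the conditional values of the consistent price systems on `[0,T]`. -/
theorem IsCPS.condExpE_le_of_upper_bound (hT : 0 < T) (h_end : 𝓕 (tEnd hT) = mΩ)
    (hSa : StronglyAdapted 𝓕 S) (hS : ∀ t ω, 0 < S t ω) (hlam0 : 0 < lam) (hlam1 : lam < 1)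
    (h_cps : ∀ lam' : ℝ, 0 < lam' → lam' ≤ lam →
      ∃ (Q : Measure Ω) (St : Set.Ici (tZero hT) → Ω → ℝ), IsCPS 𝓕 P S lam' (tZero hT) Q St)
    (hX1 : Measurable X1) (hX2 : Measurable X2)
    (hM1 : MemLpPlus 𝓕 P S lam s 1 M1) (hM2 : MemLpPlus 𝓕 P S lam s ∞ M2)
    (h_bound : ∀ᵐ ω ∂P, -M1 ω - M2 ω * S (tEnd hT) ω ≤
        X1 ω + max (X2 ω) 0 * ((1 - lam) * S (tEnd hT) ω)
          - max (-X2 ω) 0 * ((1 + lam) * S (tEnd hT) ω))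
    {Y : Ω → EReal} (hY : ∀ f ∈ condValues hT 𝓕 P S lam X1 X2 (tZero hT) s, f ≤ᵐ[P] Y)
    {St : Set.Ici s → Ω → ℝ} (h : IsCPS 𝓕 P S lam s Q St) :
    condExpE (𝓕 s) Q (payoff hT X1 X2 St) ≤ᵐ[P] Y := by
  have := h.prob
  have hm := 𝓕.le s
  have hSm : ∀ t, Measurable (S t) := fun t => (hSa t).measurable.mono (𝓕.le t) le_rfl
  have hM1m := hM1.1.mono hm le_rfl
  have hM2m := hM2.1.mono hm le_rfl
  set M : Ω → ℝ := fun ω => M1 ω + M2 ω * S (tEnd hT) ω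
  have hMm : Measurable M := hM1m.add (hM2m.mul (hSm _))
  have hM0 : ∀ᵐ ω ∂P, 0 ≤ M ω := by
    filter_upwards [hM1.2.1, hM2.2.1] with ω h1 h2
    exact add_nonneg h1 (mul_nonneg h2 (hS _ ω).le)
  have hMi := h.integrable_bound hT hlam1 hS hSm hM1 hM2
  have hXm := h.measurable_payoff hT hX1 hX2
  have hX0 := h.payoff_add_nonneg hT h_bound
  set Z : Ω → ℝ≥0∞ := fun ω => ENNReal.ofReal (payoff hT X1 X2 St ω + M ω)
  have hZm : Measurable Z := (hXm.add hMm).ennreal_ofReal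
  set N : Ω → ℝ≥0∞ := fun ω => ENNReal.ofReal (M ω)
  have hNm : Measurable N := hMm.ennreal_ofReal
  -- Dominates the conditional expectation of `M` given `𝓕 s` under every Q' used below, hence does
  -- not depend on n.
  set K : Ω → ℝ≥0∞ := fun ω => ENNReal.ofReal (M1 ω) +
    ENNReal.ofReal ((1 + lam) / (1 - lam)) * (ENNReal.ofReal (S s ω) * ENNReal.ofReal (M2 ω))
    with hK
  have hKm : Measurable[𝓕 s] K := hM1.1.ennreal_ofReal.add
    (((hSa s).measurable.ennreal_ofReal.fun_mul hM2.1.ennreal_ofReal).const_mul _)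
  have hKm' : Measurable K := hKm.mono hm le_rfl
  have hstep : ∀ n : ℕ, ∀ᵐ ω ∂P,
      ((ENNReal.ofReal (1 - 1 / ((n : ℝ) + 2)) * condLExp (𝓕 s) Q Z ω : ℝ≥0∞) : EReal) -
        ((ENNReal.ofReal (1 - 1 / ((n : ℝ) + 2)) * condLExp (𝓕 s) Q N ω +
          ENNReal.ofReal (1 / ((n : ℝ) + 2)) * K ω : ℝ≥0∞) : EReal) ≤ Y ω := by
    intro n
    set ε : ℝ := 1 / ((n : ℝ) + 2) with hε
    have hε0 : 0 < ε := by positivity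
    have hε1 : ε < 1 := by
      rw [hε, div_lt_one (by positivity)]
      linarith [(Nat.cast_nonneg n : (0 : ℝ) ≤ n)]
    have hε_lam : ε * lam < lam := by nlinarith
    have hlam0' : 0 < ε * lam / 8 := by positivity
    have hlam_le : ε * lam / 8 ≤ lam := by linarith
    -- The reduction in cost at s is about ε * lam, and the backward passage loses at most about 4 *
    -- lam'; the divisor 8 leaves ample room.
    obtain ⟨Q', St', h'⟩ := h_cps (ε * lam / 8) hlam0' hlam_le
    obtain ⟨Qm, SR, D, g, hR, hD, hD0, hD1, hSR, hg, hgQ, hQ', hdens, hdens'⟩ :=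
      h.exists_mixture hT h_end hSa hS hlam0 hlam1 hlam0' hlam_le hε0 hε1
        (by nlinarith [mul_pos hε0 hlam0, mul_pos hlam0' hlam0, mul_pos hε0 hlam0'])
        (by nlinarith [mul_pos hε0 hlam0, mul_pos hlam0' hlam0, mul_pos hε0 hlam0']) h'
    have := hR.prob
    have := h'.prob
    have hcond : ∀ F : Ω → ℝ≥0∞, Measurable F → ∀ f : Ω → ℝ≥0∞, Measurable[𝓕 s] f →
        ENNReal.ofReal (1 - ε) * ∫⁻ ω, condLExp (𝓕 s) Q F ω * f ω ∂Qm =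
          ∫⁻ ω, ENNReal.ofReal (D ω) * (F ω * f ω) ∂Qm := by
      intro F hF f hf
      rw [hdens _ (hF.fun_mul (hf.mono hm le_rfl)),
        ← hgQ _ ((measurable_condLExp (𝓕 s) Q F).fun_mul hf)]
      have := lintegral_condLExp_mul hm (P := Q) hF (hg.fun_mul hf)
      simp only [mul_left_comm (g _), this]
    -- The Q' part of the shifted payoff is nonnegative and is discarded.
    have hlower : ∀ᵐ ω ∂Qm, ENNReal.ofReal (1 - ε) * condLExp (𝓕 s) Q Z ω ≤
        condLExp (𝓕 s) Qm (fun ω => ENNReal.ofReal (payoff hT X1 X2 SR ω + M ω)) ω := by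
      refine ae_le_condLExp_of_forall_lintegral_le hm
        ((measurable_condLExp (𝓕 s) Q Z).const_mul _) fun f hf => ?_
      have hf' := hf.mono hm le_rfl
      simp only [mul_assoc]
      rw [lintegral_const_mul _ ((measurable_condLExp' (𝓕 s) Q Z).fun_mul hf'), hcond Z hZm f hf]
      refine lintegral_mono_ae ?_
      filter_upwards [hR.ac.ae_le ((h'.mono hlam_le hS).payoff_add_nonneg hT h_bound)]
        with ω hω
      rw [← mul_assoc, ← ENNReal.ofReal_mul (hD0 ω)]
      gcongr
      have heq : payoff hT X1 X2 SR ω + M ω = D ω * (payoff hT X1 X2 St ω + M ω) +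
          (1 - D ω) * (payoff hT X1 X2 St' ω + M ω) := by
        simp only [payoff, hSR]
        ring
      rw [heq]
      exact le_add_of_nonneg_right (mul_nonneg (sub_nonneg.2 (hD1 ω)) hω)
    have hupper : ∀ᵐ ω ∂Qm, condLExp (𝓕 s) Qm N ω ≤
        ENNReal.ofReal (1 - ε) * condLExp (𝓕 s) Q N ω + ENNReal.ofReal ε * K ω := by
      refine condLExp_ae_le_of_forall_lintegral_le hm
        (((measurable_condLExp (𝓕 s) Q N).const_mul _).add (hKm.const_mul _)) fun f hf => ?_
      have hf' := hf.mono hm le_rfl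
      have hNf := hNm.fun_mul hf'
      have hcN := (measurable_condLExp' (𝓕 s) Q N).fun_mul hf'
      simp only [add_mul, mul_assoc]
      rw [lintegral_add_left (hcN.const_mul _), lintegral_const_mul _ hcN,
        lintegral_const_mul _ (hKm'.fun_mul hf'), hcond N hNm f hf, ← hQ' _ (hKm.fun_mul hf)]
      have hsplit : ∫⁻ ω, N ω * f ω ∂Qm = ∫⁻ ω, ENNReal.ofReal (D ω) * (N ω * f ω) ∂Qm +
          ENNReal.ofReal ε * ∫⁻ ω, N ω * f ω ∂Q' := by
        rw [← hdens' _ hNf, ← lintegral_add_left (hD.ennreal_ofReal.fun_mul hNf)]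
        refine lintegral_congr fun ω => ?_
        rw [← add_mul, ← ENNReal.ofReal_add (hD0 ω) (sub_nonneg.2 (hD1 ω)), add_sub_cancel,
          ENNReal.ofReal_one, one_mul]
      rw [hsplit]
      refine add_le_add le_rfl (mul_le_mul_right ?_ _)
      have hφ : Measurable[𝓕 s] fun ω => ENNReal.ofReal (M2 ω) * f ω :=
        hM2.1.ennreal_ofReal.fun_mul hf
      have hφ' := hφ.mono hm le_rfl
      -- Weakening lam' to lam in the ratio makes the bound uniform in ε.
      have hprice := ofReal_mul_le_of_ratio (a := 1) (b := (1 + lam) / (1 - lam)) zero_le_one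
        (div_nonneg (by linarith) (by linarith)) (by linarith)
        (h'.lintegral_price_le hlam0'.le (by linarith) hT hS hSm (tEndFrom hT _) ⟨s, s.2.1⟩
          (hφ.mono (𝓕.mono s.2.2) le_rfl) hφ)
        (by
          rw [one_mul, div_mul_eq_mul_div (1 + lam), le_div_iff₀ (by linarith)]
          nlinarith)
      rw [ENNReal.ofReal_one, one_mul] at hprice
      calc ∫⁻ ω, N ω * f ω ∂Q'
          ≤ ∫⁻ ω, (ENNReal.ofReal (M1 ω) * f ω +
              ENNReal.ofReal (S (tEnd hT) ω) * (ENNReal.ofReal (M2 ω) * f ω)) ∂Q' := by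
            refine lintegral_mono fun ω => ?_
            rw [← mul_assoc, ← add_mul, ← ENNReal.ofReal_mul (hS _ ω).le,
              mul_comm (S (tEnd hT) ω)]
            gcongr
            exact ENNReal.ofReal_add_le
        _ = ∫⁻ ω, ENNReal.ofReal (M1 ω) * f ω ∂Q' +
              ∫⁻ ω, ENNReal.ofReal (S (tEnd hT) ω) * (ENNReal.ofReal (M2 ω) * f ω) ∂Q' :=
            lintegral_add_left (hM1m.ennreal_ofReal.fun_mul hf') _
        _ ≤ ∫⁻ ω, ENNReal.ofReal (M1 ω) * f ω ∂Q' + ENNReal.ofReal ((1 + lam) / (1 - lam)) *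
              ∫⁻ ω, ENNReal.ofReal (S s ω) * (ENNReal.ofReal (M2 ω) * f ω) ∂Q' := by
            gcongr
            exact hprice
        _ = ∫⁻ ω, K ω * f ω ∂Q' := by
            rw [← lintegral_const_mul _ ((hSm s).ennreal_ofReal.fun_mul hφ'),
              ← lintegral_add_left (hM1m.ennreal_ofReal.fun_mul hf')]
            refine lintegral_congr fun ω => ?_
            simp only [hK]
            ring
    -- Integrability of the bound is assumed only for systems on [s,T], so the extended system is
    -- restricted again.
    have hRs := hR.restrict (s := s) s.2.1
    have hval := condExpE_ae_eq_sub (𝓕 s) (Q := Qm) (M := M) (hR.measurable_payoff hT hX1 hX2) hMm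
      (hR.ac.ae_le hM0) (hR.ac.ae_le (hR.payoff_add_nonneg hT h_bound))
      (hRs.integrable_bound hT hlam1 hS hSm hM1 hM2)
    filter_upwards [hR.ac'.ae_le hlower, hR.ac'.ae_le hupper, hR.ac'.ae_le hval,
      hY _ ⟨Qm, SR, hR, rfl⟩] with ω h1 h2 h3 h4
    refine le_trans ?_ h4
    rw [h3]
    exact EReal.sub_le_sub (by exact_mod_cast h1) (by exact_mod_cast h2)
  have hNfin : ∫⁻ ω, N ω ∂Q ≠ ∞ :=
    (lintegral_ofReal_ne_top_iff_integrable hMm.aestronglyMeasurable (h.ac.ae_le hM0)).2 hMi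
  filter_upwards [ae_all_iff.2 hstep,
    h.ac'.ae_le (condExpE_ae_eq_sub (𝓕 s) (Q := Q) (M := M) hXm hMm (h.ac.ae_le hM0)
      (h.ac.ae_le hX0) hMi),
    h.ac'.ae_le (condLExp_ne_top (mΩ := 𝓕 s) hNfin)] with ω h1 h2 h3
  rw [h2]
  refine EReal_sub_le_of_forall_perturbation h3 ?_ h1
  simp only [hK]
  finiteness

end ConditionalValues

end TransactionCosts

/-! ### Equality of the two essential suprema -/

theorem theorem3p10 {Ω : Type*} {mΩ : MeasurableSpace Ω} (P : Measure Ω) [IsProbabilityMeasure P]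
    {T : ℝ} (hT : 0 < T)
    -- the filtration: usual conditions, trivial at time 0, everything at time T
    (𝓕 : Filtration (Set.Icc (0 : ℝ) T) mΩ) [𝓕.IsRightContinuous]
    (h_null : ∀ A : Set Ω, P A = 0 → ∀ t, MeasurableSet[𝓕 t] A)
    (h_triv : ∀ A : Set Ω, MeasurableSet[𝓕 (TransactionCosts.tZero hT)] A → P A = 0 ∨ P A = 1)
    (h_end : 𝓕 (TransactionCosts.tEnd hT) = mΩ)
    -- the price process
    (S : Set.Icc (0 : ℝ) T → Ω → ℝ) (hS_adapted : StronglyAdapted 𝓕 S)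
    (hS_cadlag : ∀ ω, TransactionCosts.IsCadlag fun t => S t ω)
    (hS_pos : ∀ t ω, 0 < S t ω) (hS_int : ∀ t, Integrable (S t) P)
    -- the transaction costs, and existence of consistent price systems for all smaller costs
    (lam : ℝ) (hlam_pos : 0 < lam) (hlam_lt : lam < 1)
    (h_cps : ∀ lam' : ℝ, 0 < lam' → lam' ≤ lam →
      ∃ (Q : Measure Ω) (St : Set.Ici (TransactionCosts.tZero hT) → Ω → ℝ),
        TransactionCosts.IsCPS 𝓕 P S lam' (TransactionCosts.tZero hT) Q St)
    (s : Set.Icc (0 : ℝ) T)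
    -- the contingent claim and its lower bound
    (X1 X2 : Ω → ℝ) (hX1 : Measurable X1) (hX2 : Measurable X2)
    (M1 M2 : Ω → ℝ) (hM1 : TransactionCosts.MemLpPlus 𝓕 P S lam s 1 M1)
    (hM2 : TransactionCosts.MemLpPlus 𝓕 P S lam s ∞ M2)
    (h_bound : ∀ᵐ ω ∂P,
      -M1 ω - M2 ω * S (TransactionCosts.tEnd hT) ω ≤
        X1 ω + max (X2 ω) 0 * ((1 - lam) * S (TransactionCosts.tEnd hT) ω)
          - max (-X2 ω) 0 * ((1 + lam) * S (TransactionCosts.tEnd hT) ω)) :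
    -- all the conditional expectations below are well defined, with values in (-∞, ∞]
    (∀ r ≤ s, ∀ (Q : Measure Ω) (St : Set.Ici r → Ω → ℝ),
      TransactionCosts.IsCPS 𝓕 P S lam r Q St →
        Integrable (fun ω => max (-TransactionCosts.payoff hT X1 X2 St ω) 0) Q) ∧
    -- the two essential suprema exist and coincide
    ∃ Y : Ω → EReal, Measurable[𝓕 s] Y ∧
      TransactionCosts.IsEssSup P
        (TransactionCosts.condValues hT 𝓕 P S lam X1 X2 s s) Y ∧
      TransactionCosts.IsEssSup P
        (TransactionCosts.condValues hT 𝓕 P S lam X1 X2 (TransactionCosts.tZero hT) s) Y := by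
  have hSm : ∀ t, Measurable (S t) := fun t => (hS_adapted t).measurable.mono (𝓕.le t) le_rfl
  refine ⟨fun r hrs Q St h => ?_, ?_⟩
  · refine ((h.restrict hrs).integrable_bound hT hlam_lt hS_pos hSm hM1 hM2).mono'
      ((h.measurable_payoff hT hX1 hX2).neg.max measurable_const).aestronglyMeasurable ?_
    filter_upwards [h.ac.ae_le (h.payoff_add_nonneg hT h_bound), h.ac.ae_le hM1.2.1,
      h.ac.ae_le hM2.2.1] with ω h1 h2 h3
    rw [Real.norm_of_nonneg (le_max_right _ _)]
    exact max_le (by linarith) (add_nonneg h2 (mul_nonneg h3 (hS_pos _ ω).le))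
  -- The essential supremum of the smaller family, over [0,T], serves for both: it bounds the larger
  -- family by the perturbation argument, and minimality passes up by inclusion.
  · obtain ⟨Y, hYm, hY⟩ := TransactionCosts.exists_measurable_isEssSup (𝓕.le s) P
      (TransactionCosts.condValues hT 𝓕 P S lam X1 X2 (TransactionCosts.tZero hT) s) (by
        rintro f ⟨Q, St, -, rfl⟩
        exact TransactionCosts.measurable_condExpE _ _ _)
    refine ⟨Y, hYm, ⟨hY.measurable, ?_, fun Y' hY'm hY' => hY.least Y' hY'm fun f hf =>
      hY' f (TransactionCosts.condValues_subset hT s.2.1 s hf)⟩, hY⟩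
    rintro f ⟨Q, St, h, rfl⟩
    exact h.condExpE_le_of_upper_bound hT h_end hS_adapted hS_pos hlam_pos hlam_lt h_cps hX1 hX2
      hM1 hM2 h_bound hY.upper
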